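/- \textbf{Theorem (Basic FIGA).} For $z=(x,\omega)\in\mathbb{R}^d\times\mathbb{R}^d=\mathbb{R}^{2d}$ let $\pi(z)$ denote the time-frequency shift $\pi(z)g(t)=e^{2\pi i\omega\cdot t}g(t-x)$, and let $$V_gf(z)=\langle f,\pi(z)g\rangle=\int_{\mathbb{R}^d}f(t)\,\overline{g(t-x)}\,e^{-2\pi i\omega\cdot t}\,dt$$ be the short-time Fourier transform of $f$ with window $g$. Feichtinger's algebra $M^1(\mathbb{R}^d)$ is the space of all $f$ (tempered distributions, which are then given by functions; functions that agree almost everywhere are identified) such that $V_\varphi f\in L^1(\mathbb{R}^{2d})$ for some nonzero Schwartz function $\varphi$. Let $\Lambda$ be a lattice in $\mathbb{R}^{2d}$, that is, a discrete subgroup that spans $\mathbb{R}^{2d}$ over $\mathbb{R}$, let $|\Lambda|$ be the Lebesgue measure of a fundamental domain of $\Lambda$, and let $$\Lambda^0=\{\lambda^0\in\mathbb{R}^{2d}:\ \pi(\lambda)\pi(\lambda^0)=\pi(\lambda^0)\pi(\lambda)\text{ on }L^2(\mathbb{R}^d)\text{ for all }\lambda\in\Lambda\}$$ be its adjoint lattice.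 Then for all $f_1,f_2,g_1,g_2\in M^1(\mathbb{R}^d)$, $$\sum_{\lambda\in\Lambda}V_{g_1}f_1(\lambda)\,\overline{V_{g_2}f_2(\lambda)}=|\Lambda|^{-1}\sum_{\lambda^0\in\Lambda^0}V_{g_1}g_2(\lambda^0)\,\overline{V_{f_1}f_2(\lambda^0)},$$ and both series converge absolutely. -/

import Mathlib

open MeasureTheory
open scoped ComplexConjugate SchwartzMap

noncomputable section

/-- The signal domain `ℝ^d`. -/
abbrev TimeSpace (d : ℕ) : Type := EuclideanSpace ℝ (Fin d)

/-- The time-frequency plane `ℝ^d × ℝ^d`, with Lebesgue measure as its `volume`. -/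
abbrev TFPlane (d : ℕ) : Type := TimeSpace d × TimeSpace d

/-- The time-frequency shift `π(x, ω) h (t) = e^{2π i ω · t} h(t - x)`, where `z = (x, ω)`. -/
def tfShift {d : ℕ} (z : TFPlane d) (h : TimeSpace d → ℂ) : TimeSpace d → ℂ :=
  fun t => Complex.exp (2 * Real.pi * Complex.I * (inner ℝ z.2 t : ℝ)) * h (t - z.1)

/-- The short-time Fourier transform of `f` with window `g`:
`V_g f (z) = ⟨f, π(z) g⟩ = ∫ f(t) conj (π(z) g (t)) dt`. -/
def stft {d : ℕ} (g f : TimeSpace d → ℂ) (z : TFPlane d) : ℂ :=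
  ∫ t : TimeSpace d, f t * conj (tfShift z g t)

/-- Membership in Feichtinger's algebra `M^1(ℝ^d)`: `f` is a function that acts on Schwartz
functions by integration (a tempered distribution), and its short-time Fourier transform with
respect to some nonzero Schwartz window is Lebesgue integrable on the time-frequency plane. -/
structure MemFeichtingerAlgebra {d : ℕ} (f : TimeSpace d → ℂ) : Prop where
  integrable_mul_schwartz : ∀ φ : 𝓢(TimeSpace d, ℂ), Integrable (fun t => f t * φ t)
  exists_window : ∃ φ : 𝓢(TimeSpace d, ℂ), φ ≠ 0 ∧ Integrable (stft (d := d) φ f)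

/-- The adjoint `Λ⁰` of a set `Λ` in the time-frequency plane: all points whose time-frequency
shift commutes, as an operator on `L²(ℝ^d)`, with every `π(l)`, `l ∈ Λ`. -/
def adjointLattice {d : ℕ} (Λ : Set (TFPlane d)) : Set (TFPlane d) :=
  {z | ∀ l ∈ Λ, ∀ h : TimeSpace d → ℂ, MemLp h 2 →
    tfShift l (tfShift z h) =ᵐ[volume] tfShift z (tfShift l h)}

end

noncomputable section

/-! ### Gaussian sums over lattices, uniform in the translation. -/

section LatticeSums

/-! Both sides of the identity are linear or conjugate-linear in each of the four functions, and
every element of `M^1` is an `L¹` superposition of time-frequency shifts of the Gaussian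
(`MemFeichtingerAlgebra.exists_ae_eq_integral_tfShift`, from the inversion formula of the short-time
Fourier transform). So the identity need only be known for shifted Gaussians, provided that the
lattice sums are bounded uniformly in the shifts; the superposition can then be pulled out of both
series by Fubini (`summable_and_tsum_integral_mul`).

For shifted Gaussians all transforms are explicit. `V_{π(w)φ} π(z)φ` is, up to a phase, a constant
times a Gaussian centred at `z - w`, which gives the uniform bounds
(`exists_tsum_norm_gaussStft_le`). The symplectic Fourier transform of `V_{g₁}f₁ · conj V_{g₂}f₂` is
`V_{g₁}g₂ · conj V_{f₁}f₂` (`integral_gaussStft_mul`). Two time-frequency shifts commute exactly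
when the symplectic form of their parameters is an integer, so `Λ⁰` is the symplectic dual of `Λ`,
and the identity is Poisson summation over `Λ` (`tsum_gaussStft_mul`). The covolume is the Jacobian
of lattice coordinates. -/

theorem exp_neg_mul_norm_add_sq_le {V : Type*} [SeminormedAddCommGroup V] {a : ℝ} (ha : 0 < a)
    (u v : V) :
    Real.exp (-a * ‖u + v‖ ^ 2) ≤ Real.exp (a * ‖v‖ ^ 2) * Real.exp (-(a / 2) * ‖u‖ ^ 2) := by
  rw [← Real.exp_add]
  gcongr
  have h : ‖u‖ ≤ ‖u + v‖ + ‖v‖ := by simpa using norm_sub_le (u + v) v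
  -- Squaring the triangle inequality costs a factor 2, hence the halved rate `a / 2`.
  have h3 : ‖u‖ ^ 2 ≤ 2 * ‖u + v‖ ^ 2 + 2 * ‖v‖ ^ 2 := by
    nlinarith [norm_nonneg u, norm_nonneg (u + v), norm_nonneg v, sq_nonneg (‖u + v‖ - ‖v‖)]
  nlinarith

variable {ι V : Type*} [Fintype ι] [NormedAddCommGroup V] [NormedSpace ℝ V]

/-- A Gaussian is summable over the lattice spanned by a basis. -/
theorem summable_exp_neg_mul_norm_sq_basis (b : Module.Basis ι ℝ V) {a : ℝ} (ha : 0 < a) :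
    Summable fun n : ι → ℤ => Real.exp (-a * ‖∑ i, (n i : ℝ) • b i‖ ^ 2) := by
  classical
  have : FiniteDimensional ℝ V := b.finiteDimensional_of_finite
  let L : Submodule ℤ V := Submodule.span ℤ (Set.range b)
  -- An exponent above the rank makes inverse powers of the norm summable; the even exponent `2 * m`
  -- compares with `(a y²)^m / m! ≤ exp (a y²)`.
  let m : ℕ := Module.finrank ℤ L + 1
  have h0 := ZLattice.summable_norm_pow_inv L (2 * m) (by omega)
  let e := (b.restrictScalars ℤ).equivFun.symm
  have he : ∀ n : ι → ℤ, ((e n : L) : V) = ∑ i, (n i : ℝ) • b i := by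
    intro n
    simp [e, Module.Basis.equivFun_symm_apply, Int.cast_smul_eq_zsmul]
  have h1 : Summable fun n : ι → ℤ => ‖∑ i, (n i : ℝ) • b i‖⁻¹ ^ (2 * m) := by
    have := e.toEquiv.summable_iff.2 h0
    refine this.congr fun n => ?_
    simp [← he]
  -- The comparison fails at `n = 0`, where the inverse is `0` by convention, so it is only required
  -- for cofinitely many `n`.
  refine Summable.of_norm_bounded_eventually (h1.mul_left ((m.factorial : ℝ) / a ^ m)) ?_
  have hfin : {n : ι → ℤ | ¬ (n ≠ 0)}.Finite := by simp
  refine (Filter.eventually_cofinite.2 hfin).mono fun n hn => ?_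
  have hpos : 0 < ‖∑ i, (n i : ℝ) • b i‖ := by
    rw [norm_pos_iff, ← he]
    intro h
    exact hn (e.map_eq_zero_iff.1 (Subtype.ext h))
  set y := ‖∑ i, (n i : ℝ) • b i‖
  have h2 := Real.pow_div_factorial_le_exp (a * y ^ 2) (by positivity) m
  rw [Real.norm_of_nonneg (Real.exp_pos _).le, neg_mul, Real.exp_neg]
  calc (Real.exp (a * y ^ 2))⁻¹ ≤ ((a * y ^ 2) ^ m / m.factorial)⁻¹ := by gcongr
    _ = _ := by
      rw [pow_mul, inv_div, mul_pow, inv_pow, inv_pow]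
      field_simp

/-- Sums of translates of a Gaussian over a lattice are bounded uniformly in the translation. -/
theorem exists_tsum_exp_neg_mul_norm_sub_sq_le (b : Module.Basis ι ℝ V) {a : ℝ} (ha : 0 < a) :
    ∃ B : ℝ, ∀ u : V,
      Summable (fun n : ι → ℤ => Real.exp (-a * ‖(∑ i, (n i : ℝ) • b i) + u‖ ^ 2)) ∧
      ∑' n : ι → ℤ, Real.exp (-a * ‖(∑ i, (n i : ℝ) • b i) + u‖ ^ 2) ≤ B := by
  have hs := summable_exp_neg_mul_norm_sq_basis b (half_pos ha)
  set R : ℝ := ∑ i, ‖b i‖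
  refine ⟨Real.exp (a * R ^ 2) * ∑' n : ι → ℤ,
    Real.exp (-(a / 2) * ‖∑ i, (n i : ℝ) • b i‖ ^ 2), fun u => ?_⟩
  -- The integer part of `u` is absorbed by reindexing the sum; the fractional part `r` stays in a
  -- bounded cell, which makes the bound independent of `u`.
  let k : ι → ℤ := fun i => ⌊b.equivFun u i⌋
  let r : V := ∑ i, Int.fract (b.equivFun u i) • b i
  have hr : ‖r‖ ≤ R := by
    refine (norm_sum_le _ _).trans (Finset.sum_le_sum fun i _ => ?_)
    rw [norm_smul, Real.norm_of_nonneg (Int.fract_nonneg _)]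
    exact mul_le_of_le_one_left (norm_nonneg _) (Int.fract_lt_one _).le
  have hu : u = (∑ i, (k i : ℝ) • b i) + r := by
    conv_lhs => rw [← b.sum_equivFun u]
    rw [← Finset.sum_add_distrib]
    refine Finset.sum_congr rfl fun i _ => ?_
    rw [← add_smul, Int.floor_add_fract]
  have key : ∀ n : ι → ℤ, Real.exp (-a * ‖(∑ i, (n i : ℝ) • b i) + r‖ ^ 2) ≤
      Real.exp (a * R ^ 2) * Real.exp (-(a / 2) * ‖∑ i, (n i : ℝ) • b i‖ ^ 2) := by
    intro n
    refine (exp_neg_mul_norm_add_sq_le ha _ _).trans ?_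
    gcongr
  have hsum := Summable.of_nonneg_of_le (fun n => (Real.exp_pos _).le) key (hs.mul_left _)
  have hre : (fun n : ι → ℤ => Real.exp (-a * ‖(∑ i, (n i : ℝ) • b i) + u‖ ^ 2)) =
      (fun n : ι → ℤ => Real.exp (-a * ‖(∑ i, (n i : ℝ) • b i) + r‖ ^ 2)) ∘
        (Equiv.addRight k) := by
    ext n
    simp only [Function.comp, Equiv.coe_addRight, Pi.add_apply, Int.cast_add, add_smul,
      Finset.sum_add_distrib, add_assoc, ← hu]
  rw [hre, (Equiv.addRight k).summable_iff]
  refine ⟨hsum, ?_⟩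
  simp only [Function.comp_def]
  rw [(Equiv.addRight k).tsum_eq
    (fun n : ι → ℤ => Real.exp (-a * ‖(∑ i, (n i : ℝ) • b i) + r‖ ^ 2)), ← tsum_mul_left]
  exact hsum.tsum_le_tsum key (hs.mul_left _)

end LatticeSums

/-! ### Poisson summation on `ℤ^ι`. -/

section Poisson

/-- The point of `ℝ^ι` with the given integer coordinates. -/
def intVec {ι : Type*} (n : ι → ℤ) : ι → ℝ := fun i => n i

variable {ι : Type*} [Fintype ι]

theorem sum_smul_basisFun (n : ι → ℤ) :
    ∑ i, (n i : ℝ) • Pi.basisFun ℝ ι i = intVec n := by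
  classical
  ext j
  simp [intVec, Pi.single_apply]

theorem intVec_add {ι : Type*} (m n : ι → ℤ) : intVec (m + n) = intVec m + intVec n := by
  ext; simp [intVec]

theorem mFourier_coe (n : ι → ℤ) (x : ι → ℝ) :
    UnitAddTorus.mFourier n (fun i => (x i : UnitAddCircle)) =
      Complex.exp (2 * Real.pi * Complex.I * ((∑ i, (n i : ℝ) * x i : ℝ) : ℂ)) := by
  simp only [UnitAddTorus.mFourier, ContinuousMap.coe_mk, fourier_coe_apply]
  rw [← Complex.exp_sum]
  congr 1
  push_cast
  rw [Finset.mul_sum]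
  refine Finset.sum_congr rfl fun i _ => ?_
  simp only [div_one]
  ring

theorem integrable_of_norm_le_exp {f : (ι → ℝ) → ℂ} (hf : Continuous f) {C a : ℝ} (ha : 0 < a)
    (hb : ∀ x, ‖f x‖ ≤ C * Real.exp (-a * ‖x‖ ^ 2)) : Integrable f := by
  -- The norm is the sup norm, so the sum of squares is at most `card ι * ‖x‖²`; the `+ 1` keeps the
  -- divisor positive when `ι` is empty.
  have hd := GaussianFourier.integrable_cexp_neg_mul_sum_add (ι := ι) (b := (a / (Fintype.card ι + 1) : ℝ))
    (by rw [Complex.ofReal_re]; positivity) 0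
  refine (hd.norm.const_mul |C|).mono' hf.aestronglyMeasurable (.of_forall fun x => ?_)
  refine (hb x).trans ?_
  rw [Complex.norm_exp]
  have hn : ∑ i, x i ^ 2 ≤ (Fintype.card ι + 1) * ‖x‖ ^ 2 := by
    calc ∑ i, x i ^ 2 ≤ ∑ _i : ι, ‖x‖ ^ 2 := by
          refine Finset.sum_le_sum fun i _ => ?_
          rw [← sq_abs]
          exact pow_le_pow_left₀ (abs_nonneg _) (norm_le_pi_norm x i) 2
      _ = Fintype.card ι * ‖x‖ ^ 2 := by simp
      _ ≤ _ := by nlinarith [sq_nonneg ‖x‖]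
  gcongr
  · exact le_abs_self C
  · have : (-(((a / (Fintype.card ι + 1) : ℝ)) : ℂ) * ∑ i, (x i : ℂ) ^ 2 +
        ∑ i, (0 : ι → ℂ) i * x i).re = -(a / (Fintype.card ι + 1)) * ∑ i, x i ^ 2 := by
      have h : (-(((a / (Fintype.card ι + 1) : ℝ)) : ℂ) * ∑ i, (x i : ℂ) ^ 2 +
        ∑ i, (0 : ι → ℂ) i * x i) = ((-(a / (Fintype.card ι + 1)) * ∑ i, x i ^ 2 : ℝ) : ℂ) := by
        push_cast; simp
      rw [h, Complex.ofReal_re]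
    rw [this, neg_mul, neg_mul, neg_le_neg_iff, div_mul_eq_mul_div, div_le_iff₀ (by positivity)]
    nlinarith

/-- **Poisson summation** for functions on `ℝ^ι` with Gaussian decay and summable Fourier
coefficients. -/
theorem tsum_intVec_eq_tsum_fourier {f : (ι → ℝ) → ℂ} (hf : Continuous f) {C a : ℝ} (ha : 0 < a)
    (hb : ∀ x, ‖f x‖ ≤ C * Real.exp (-a * ‖x‖ ^ 2))
    (hs : Summable fun n : ι → ℤ =>
      ∫ x, Complex.exp (2 * Real.pi * Complex.I * ((∑ i, ((-n) i : ℝ) * x i : ℝ) : ℂ)) * f x) :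
    ∑' n : ι → ℤ, f (intVec n) = ∑' n : ι → ℤ,
      ∫ x, Complex.exp (2 * Real.pi * Complex.I * ((∑ i, ((-n) i : ℝ) * x i : ℝ) : ℂ)) * f x := by
  classical
  let q : (ι → ℝ) → UnitAddTorus ι := fun x i => (x i : UnitAddCircle)
  let s : UnitAddTorus ι → (ι → ℝ) := fun y i => AddCircle.equivIco 1 0 (y i)
  have hqs : ∀ y, q (s y) = y := fun y => by
    ext i
    exact (AddCircle.equivIco 1 0).symm_apply_apply (y i)
  have hq : ∀ x y, q x = q y → ∃ k : ι → ℤ, x = y + intVec k := fun x y h => by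
    have : ∀ i, ∃ k : ℤ, x i = y i + k := fun i => by
      have h1 : (x i : UnitAddCircle) = y i := congrFun h i
      rw [← sub_eq_zero, ← AddCircle.coe_sub, AddCircle.coe_eq_zero_iff] at h1
      obtain ⟨k, hk⟩ := h1
      exact ⟨k, by simp at hk; linarith⟩
    choose k hk using this
    exact ⟨k, funext hk⟩
  -- `P` is the periodization of `f`. It descends through the section `s` to a function `p` on the
  -- torus, whose Fourier series at the origin is the claim.
  let P : (ι → ℝ) → ℂ := fun x => ∑' n : ι → ℤ, f (intVec n + x)
  have hPper : ∀ x k, P (x + intVec k) = P x := fun x k => by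
    refine Eq.trans ?_ ((Equiv.addRight k).tsum_eq fun n => f (intVec n + x))
    refine tsum_congr fun n => ?_
    simp only [Equiv.coe_addRight, intVec_add]
    congr 1; abel
  let S : ℝ → (ι → ℤ) → ℝ := fun R n =>
    |C| * (Real.exp (a * R ^ 2) * Real.exp (-(a / 2) * ‖intVec n‖ ^ 2))
  have hS : ∀ R, Summable (S R) := fun R => by
    have := summable_exp_neg_mul_norm_sq_basis (Pi.basisFun ℝ ι) (half_pos ha)
    simp only [sum_smul_basisFun] at this
    exact (this.mul_left _).mul_left _
  have hSb : ∀ R, ∀ x : ι → ℝ, ‖x‖ ≤ R → ∀ n, ‖f (intVec n + x)‖ ≤ S R n := fun R x hx n => by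
    refine (hb _).trans ?_
    have h1 := exp_neg_mul_norm_add_sq_le ha (intVec n) x
    calc C * Real.exp (-a * ‖intVec n + x‖ ^ 2) ≤ |C| * Real.exp (-a * ‖intVec n + x‖ ^ 2) := by
          gcongr; exact le_abs_self C
      _ ≤ |C| * (Real.exp (a * ‖x‖ ^ 2) * Real.exp (-(a / 2) * ‖intVec n‖ ^ 2)) := by gcongr
      _ ≤ S R n := by simp only [S]; gcongr
  have hPc : Continuous P := by
    rw [continuous_iff_continuousAt]
    intro x
    have : ContinuousOn P (Metric.ball 0 (‖x‖ + 1)) := by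
      refine continuousOn_tsum (fun n => by fun_prop) (hS (‖x‖ + 1)) fun n y hy => hSb _ _ ?_ _
      exact (mem_ball_zero_iff.1 hy).le
    exact this.continuousAt (Metric.isOpen_ball.mem_nhds (by simp))
  let p : UnitAddTorus ι → ℂ := fun y => P (s y)
  have hpq : ∀ x, p (q x) = P x := fun x => by
    obtain ⟨k, hk⟩ := hq (s (q x)) x (hqs _)
    simp only [p, hk, hPper]
  have hquot : IsOpenQuotientMap q :=
    IsOpenQuotientMap.piMap (fun _ => QuotientAddGroup.isOpenQuotientMap_mk)
  have hpc : Continuous p := by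
    rw [hquot.isQuotientMap.continuous_iff]
    exact hPc.congr fun x => (hpq x).symm
  have hint : Integrable f := integrable_of_norm_le_exp hf ha hb
  -- Unfolding: the character is periodic, so integrating it against the periodization over one cell
  -- is integrating it against `f` over the whole space.
  have hcoef : ∀ n : ι → ℤ, UnitAddTorus.mFourierCoeff (⟨p, hpc⟩ : C(UnitAddTorus ι, ℂ)) n =
      ∫ x, Complex.exp (2 * Real.pi * Complex.I * ((∑ i, ((-n) i : ℝ) * x i : ℝ) : ℂ)) * f x := by
    intro n
    rw [UnitAddTorus.mFourierCoeff_eq_integral _ n 0]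
    let b := Pi.basisFun ℝ ι
    let E : (ι → ℝ) → ℂ := fun x =>
      Complex.exp (2 * Real.pi * Complex.I * ((∑ i, ((-n) i : ℝ) * x i : ℝ) : ℂ))
    have hEc : Continuous E := by fun_prop
    have hEn : ∀ x, ‖E x‖ = 1 := fun x => by
      have := Complex.norm_exp_ofReal_mul_I (2 * Real.pi * ∑ i, ((-n) i : ℝ) * x i)
      rw [← this]
      simp only [E]
      congr 2
      push_cast
      ring
    have hEper : ∀ m x, E (intVec m + x) = E x := fun m x => by
      have : 2 * Real.pi * Complex.I * ((∑ i, ((-n) i : ℝ) * (intVec m + x) i : ℝ) : ℂ) =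
          2 * Real.pi * Complex.I * ((∑ i, ((-n) i : ℝ) * x i : ℝ) : ℂ) +
            ((∑ i, (-n) i * m i : ℤ) : ℂ) * (2 * Real.pi * Complex.I) := by
        simp only [Pi.add_apply, intVec, mul_add, Finset.sum_add_distrib]
        push_cast
        ring
      simp only [E, this, Complex.exp_add, Complex.exp_int_mul_two_pi_mul_I, mul_one]
    let D : Set (ι → ℝ) := ZSpan.fundamentalDomain b
    have hD : D = Set.pi Set.univ fun i => Set.Ico (0 : ℝ) 1 := by
      ext x
      simp [D, b, ZSpan.mem_fundamentalDomain]
    -- The torus integral uses half-open boxes `Ioc`, the fundamental domain boxes `Ico`; they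
    -- differ by a null set.
    have hset : {x : ι → ℝ | ∀ i, x i ∈ Set.Ioc ((0 : ι → ℝ) i) ((0 : ι → ℝ) i + 1)}
        =ᵐ[volume] D := by
      have h1 := Measure.univ_pi_Ioc_ae_eq_Icc (μ := fun _ : ι => (volume : Measure ℝ))
        (f := fun _ => (0 : ℝ)) (g := fun _ => 1)
      have h2 := Measure.univ_pi_Ico_ae_eq_Icc (μ := fun _ : ι => (volume : Measure ℝ))
        (f := fun _ => (0 : ℝ)) (g := fun _ => 1)
      rw [hD]
      have h3 : {x : ι → ℝ | ∀ i, x i ∈ Set.Ioc ((0 : ι → ℝ) i) ((0 : ι → ℝ) i + 1)} =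
          Set.pi Set.univ fun i => Set.Ioc (0 : ℝ) 1 := by
        ext x
        simp
      rw [h3]
      exact h1.trans h2.symm
    rw [setIntegral_congr_set hset]
    have hDn : ∀ x ∈ D, ‖x‖ ≤ 1 := fun x hx => by
      rw [hD] at hx
      refine (pi_norm_le_iff_of_nonneg zero_le_one).2 fun i => ?_
      have := hx i trivial
      rw [Real.norm_of_nonneg this.1]
      exact this.2.le
    have hDm : MeasurableSet D := ZSpan.fundamentalDomain_measurableSet b
    have hDv : volume D = 1 := by
      rw [hD, Real.volume_pi_Ico]; simp
    have hfun : ∀ x : ι → ℝ, UnitAddTorus.mFourier (-n) (fun i => (x i : UnitAddCircle)) •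
        (⟨p, hpc⟩ : C(UnitAddTorus ι, ℂ)) (fun i => (x i : UnitAddCircle)) =
        ∑' m : ι → ℤ, E (intVec m + x) * f (intVec m + x) := fun x => by
      simp only [hEper]
      rw [tsum_mul_left, mFourier_coe, smul_eq_mul]
      exact congrArg _ (hpq x)
    simp only [hfun]
    have hEf : Integrable fun x => E x * f x :=
      hint.bdd_mul hEc.aestronglyMeasurable (c := 1) (.of_forall fun x => (hEn x).le)
    have : VAddInvariantMeasure (Submodule.span ℤ (Set.range b)) (ι → ℝ) volume :=
      (inferInstance : VAddInvariantMeasure (Submodule.span ℤ (Set.range b)).toAddSubgroup _ _)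
    rw [(ZSpan.isAddFundamentalDomain b volume).integral_eq_tsum'' _ hEf]
    let e := (b.restrictScalars ℤ).equivFun.symm
    have he : ∀ m : ι → ℤ, ((e m : Submodule.span ℤ (Set.range b)) : ι → ℝ) = intVec m := by
      intro m
      rw [← sum_smul_basisFun]
      simp [e, b, Module.Basis.equivFun_symm_apply, Int.cast_smul_eq_zsmul]
    rw [← e.toEquiv.tsum_eq]
    have hterm : ∀ m : ι → ℤ, ∫ x in D, E (e.toEquiv m +ᵥ x) * f (e.toEquiv m +ᵥ x) =
        ∫ x in D, E (intVec m + x) * f (intVec m + x) := fun m => by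
      simp only [LinearEquiv.coe_toEquiv, Submodule.vadd_def, he, vadd_eq_add]
    rw [tsum_congr hterm]
    have hmeas : ∀ m : ι → ℤ, Continuous fun x => E (intVec m + x) * f (intVec m + x) :=
      fun m => by fun_prop
    have hbd : ∀ m : ι → ℤ, ∀ x ∈ D, ‖E (intVec m + x) * f (intVec m + x)‖ ≤ S 1 m :=
      fun m x hx => by
        rw [norm_mul, hEn, one_mul]
        exact hSb 1 x (hDn x hx) m
    have hii : ∀ m : ι → ℤ, IntegrableOn (fun x => E (intVec m + x) * f (intVec m + x)) D :=
      fun m => Measure.integrableOn_of_bounded (by simp [hDv]) (hmeas m).aestronglyMeasurable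
        ((ae_restrict_iff' hDm).2 (.of_forall (hbd m)))
    refine (integral_tsum_of_summable_integral_norm hii ?_).symm
    refine Summable.of_nonneg_of_le (fun m => integral_nonneg fun x => norm_nonneg _)
      (fun m => ?_) (hS 1)
    calc ∫ x in D, ‖E (intVec m + x) * f (intVec m + x)‖ ≤ ∫ x in D, S 1 m :=
          setIntegral_mono_on (hii m).norm (by simp [hDv]) hDm (hbd m)
      _ = S 1 m := by simp [Measure.real, hDv]
  have hmain := UnitAddTorus.hasSum_mFourier_series_apply_of_summable
    (f := (⟨p, hpc⟩ : C(UnitAddTorus ι, ℂ))) (by simpa only [funext hcoef] using! hs) (q 0)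
  have h0 : ∀ n : ι → ℤ, UnitAddTorus.mFourier n (q 0) = 1 := fun n => by
    rw [mFourier_coe]; simp
  simp only [h0, hcoef, smul_eq_mul, mul_one] at hmain
  rw [hmain.tsum_eq]
  change _ = p (q 0)
  simp [hpq, P]

end Poisson

/-! ### Change of variables to lattice coordinates. -/

section Covolume

variable {ι V : Type*} [Fintype ι] [NormedAddCommGroup V] [NormedSpace ℝ V] [FiniteDimensional ℝ V]
  [MeasurableSpace V] [BorelSpace V]

/-- Integration in the coordinates given by a lattice basis. -/
theorem integral_comp_ofZLatticeBasis (μ : Measure V) [μ.IsAddHaarMeasure] (Λ : Submodule ℤ V)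
    [DiscreteTopology Λ] [IsZLattice ℝ Λ] (b : Module.Basis ι ℤ Λ) (F : V → ℂ) :
    ∫ x : ι → ℝ, F (∑ i, x i • (b.ofZLatticeBasis ℝ Λ) i) =
      ((ZLattice.covolume Λ μ : ℝ) : ℂ)⁻¹ * ∫ v, F v ∂μ := by
  classical
  set B := b.ofZLatticeBasis ℝ Λ
  let e : (ι → ℝ) ≃L[ℝ] V := B.equivFun.symm.toContinuousLinearEquiv
  have he : ∀ x, e x = ∑ i, x i • B i := fun x => B.equivFun_symm_apply x
  have h1 : ∫ x : ι → ℝ, F (∑ i, x i • B i) = ∫ v, F v ∂(Measure.map e volume) := by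
    simp only [← he]
    exact (e.toHomeomorph.measurableEmbedding.integral_map F).symm
  have hH : (Measure.map e (volume : Measure (ι → ℝ))).IsAddHaarMeasure :=
    e.isAddHaarMeasure_map volume
  -- By uniqueness of Haar measure the pushforward of Lebesgue measure is `c • μ`. The fundamental
  -- domain has pushforward measure 1, which forces `c` to be the inverse covolume.
  set c := (Measure.map e (volume : Measure (ι → ℝ))).addHaarScalarFactor μ with hc
  have h2 : Measure.map e (volume : Measure (ι → ℝ)) = c • μ :=
    Measure.isAddLeftInvariant_eq_smul _ _
  have h3 : (Measure.map e (volume : Measure (ι → ℝ))) (ZSpan.fundamentalDomain B) = 1 := by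
    rw [Measure.map_apply e.continuous.measurable (ZSpan.fundamentalDomain_measurableSet B)]
    have : e ⁻¹' (ZSpan.fundamentalDomain B) = Set.pi Set.univ fun _ => Set.Ico (0 : ℝ) 1 := by
      ext x
      have : ∀ i, B.repr (e x) i = x i := fun i => by
        rw [he, ← B.equivFun_symm_apply, ← B.equivFun_apply, LinearEquiv.apply_symm_apply]
      simp [ZSpan.mem_fundamentalDomain, this]
    rw [this, Real.volume_pi_Ico]
    simp
  have h4 : (c : ℝ) * ZLattice.covolume Λ μ = 1 := by
    rw [ZLattice.covolume_eq_measure_fundamentalDomain Λ μ (ZLattice.isAddFundamentalDomain b μ)]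
    rw [h2] at h3
    have := congrArg ENNReal.toReal h3
    simpa [Measure.real, B] using! this
  rw [h1, h2, integral_smul_nnreal_measure]
  have h5 : (c : ℝ) = (ZLattice.covolume Λ μ)⁻¹ := eq_inv_of_mul_eq_one_left h4
  rw [NNReal.smul_def, h5, Complex.real_smul, Complex.ofReal_inv]

end Covolume

/-! ### Explicit transforms of shifted Gaussians. -/

section Gaussian

variable {d : ℕ}

instance : (volume : Measure (TFPlane d)).IsAddHaarMeasure :=
  inferInstanceAs ((volume : Measure (TimeSpace d)).prod volume).IsAddHaarMeasure

/-- The standard Gaussian `exp (-π |t|²)`. -/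
def stdGaussian (t : TimeSpace d) : ℂ := Complex.exp (-Real.pi * ∑ i, (t i : ℂ) ^ 2)

/-- The short-time Fourier transform of a time-frequency shifted Gaussian with respect to
another one. -/
def gaussStft (w z l : TFPlane d) : ℂ := stft (tfShift w stdGaussian) (tfShift z stdGaussian) l

/-- The contribution of one coordinate to the exponent of `gaussStft`. -/
def stftExponent (w z l : ℝ × ℝ) : ℂ :=
  Real.pi / 2 * ((z.1 + w.1 + l.1) + Complex.I * (z.2 - w.2 - l.2)) ^ 2 - Real.pi * z.1 ^ 2 +
    2 * Real.pi * Complex.I * w.2 * l.1 - Real.pi * (l.1 + w.1) ^ 2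

theorem ofReal_inner_eq_sum (x y : TimeSpace d) :
    ((inner ℝ x y : ℝ) : ℂ) = ∑ i, (x i : ℂ) * y i := by
  simp [PiLp.inner_apply, mul_comm]

theorem integral_cexp_neg_mul_sum_add_timeSpace {β : ℂ} (hβ : 0 < β.re) (c : Fin d → ℂ) :
    ∫ v : TimeSpace d, Complex.exp (-β * ∑ i, (v i : ℂ) ^ 2 + ∑ i, c i * v i) =
      (Real.pi / β) ^ (d / 2 : ℂ) * Complex.exp ((∑ i, c i ^ 2) / (4 * β)) := by
  rw [← (PiLp.volume_preserving_toLp (Fin d)).integral_comp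
    (MeasurableEquiv.toLp 2 _).measurableEmbedding]
  simpa using GaussianFourier.integral_cexp_neg_mul_sum_add hβ c

/-- The integrand is the exponential of a quadratic in `t` with leading coefficient `-2π`;
completing the square in each coordinate gives the factor `(π / 2π)^(d/2)` and the exponent. -/
theorem gaussStft_eq (w z l : TFPlane d) :
    gaussStft w z l = (1 / 2 : ℂ) ^ (d / 2 : ℂ) *
      Complex.exp (∑ i, stftExponent (w.1 i, w.2 i) (z.1 i, z.2 i) (l.1 i, l.2 i)) := by
  let c : Fin d → ℂ := fun i =>
    2 * Real.pi * ((z.1 i + w.1 i + l.1 i) + Complex.I * (z.2 i - w.2 i - l.2 i))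
  let k : ℂ := ∑ i, (-Real.pi * (z.1 i : ℂ) ^ 2 + 2 * Real.pi * Complex.I * w.2 i * l.1 i -
    Real.pi * (l.1 i + w.1 i) ^ 2)
  have h : ∀ t : TimeSpace d, tfShift z stdGaussian t * conj (tfShift l (tfShift w stdGaussian) t) =
      Complex.exp k *
        Complex.exp (-(2 * Real.pi) * ∑ i, (t i : ℂ) ^ 2 + ∑ i, c i * t i) := by
    intro t
    simp only [tfShift, stdGaussian, ← Complex.exp_conj, ← Complex.exp_add,
      ofReal_inner_eq_sum]
    congr 1
    simp only [map_sum, Finset.mul_sum, ← Finset.sum_add_distrib, k]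
    refine Finset.sum_congr rfl fun i _ => ?_
    simp only [map_add, map_sub, map_mul, map_neg, map_pow, Complex.conj_ofReal,
      Complex.conj_I, map_ofNat, PiLp.sub_apply, Complex.ofReal_sub, c]
    ring
  have hβ : 0 < (2 * Real.pi : ℂ).re := by
    simp [Real.pi_pos]
  unfold gaussStft stft
  simp only [h]
  rw [integral_const_mul, integral_cexp_neg_mul_sum_add_timeSpace hβ]
  have hpi : (Real.pi : ℂ) ≠ 0 := Complex.ofReal_ne_zero.2 Real.pi_ne_zero
  rw [show (Real.pi / (2 * Real.pi) : ℂ) = 1 / 2 by field_simp, mul_left_comm, ← Complex.exp_add]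
  congr 2
  simp only [k, Finset.sum_div, ← Finset.sum_add_distrib]
  refine Finset.sum_congr rfl fun i _ => ?_
  simp only [c, stftExponent]
  field_simp
  ring

/-- Only `l + w - z` enters the modulus. This makes the decay estimates uniform in the shifts `w`
and `z`. -/
theorem re_stftExponent (w z l : ℝ × ℝ) : (stftExponent w z l).re =
    -(Real.pi / 2) * ((l.1 + (w.1 - z.1)) ^ 2 + (l.2 + (w.2 - z.2)) ^ 2) := by
  simp [stftExponent, pow_two]
  ring

theorem norm_sq_le_sum (l : TFPlane d) : ‖l‖ ^ 2 ≤ ∑ i, ((l.1 i) ^ 2 + (l.2 i) ^ 2) := by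
  rw [Finset.sum_add_distrib, ← EuclideanSpace.real_norm_sq_eq, ← EuclideanSpace.real_norm_sq_eq]
  rw [Prod.norm_def]
  rcases max_choice ‖l.1‖ ‖l.2‖ with h | h <;> rw [h] <;> nlinarith [sq_nonneg ‖l.1‖, sq_nonneg ‖l.2‖]

theorem norm_gaussStft_le (w z l : TFPlane d) :
    ‖gaussStft w z l‖ ≤ Real.exp (-(Real.pi / 2) * ‖l + (w - z)‖ ^ 2) := by
  rw [gaussStft_eq, norm_mul, Complex.norm_exp, Complex.re_sum]
  have h1 : ‖(1 / 2 : ℂ) ^ (d / 2 : ℂ)‖ ≤ 1 := by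
    have : ((1 / 2 : ℂ) ^ (d / 2 : ℂ)) = (((1 / 2 : ℝ) ^ (d / 2 : ℝ) : ℝ) : ℂ) := by
      rw [Complex.ofReal_cpow (by norm_num)]; push_cast; rfl
    rw [this, Complex.norm_real, Real.norm_of_nonneg (by positivity)]
    exact Real.rpow_le_one (by norm_num) (by norm_num) (by positivity)
  refine (mul_le_of_le_one_left (Real.exp_pos _).le h1).trans ?_
  simp only [re_stftExponent, ← Finset.mul_sum]
  have := norm_sq_le_sum (l + (w - z))
  rw [Real.exp_le_exp, neg_mul, neg_mul, neg_le_neg_iff]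
  have h2 : 0 ≤ Real.pi / 2 := by positivity
  exact mul_le_mul_of_nonneg_left this h2

theorem norm_gaussStft_le_one (w z l : TFPlane d) : ‖gaussStft w z l‖ ≤ 1 :=
  (norm_gaussStft_le w z l).trans (Real.exp_le_one_iff.2 (by
    have := Real.pi_pos
    nlinarith [sq_nonneg ‖l + (w - z)‖]))

theorem continuous_gaussStft :
    Continuous fun p : TFPlane d × TFPlane d × TFPlane d => gaussStft p.1 p.2.1 p.2.2 := by
  simp only [gaussStft_eq, stftExponent]
  fun_prop

attribute [irreducible] gaussStft

theorem continuous_gaussStft_right (w z : TFPlane d) : Continuous (gaussStft w z) :=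
  continuous_gaussStft.comp (by fun_prop : Continuous fun l => (w, z, l))

/-- The symplectic form on the time-frequency plane. -/
def symplecticForm (d : ℕ) : TFPlane d →ₗ[ℝ] TFPlane d →ₗ[ℝ] ℝ :=
  (innerₗ (TimeSpace d)).compl₁₂ (LinearMap.snd ℝ _ _) (LinearMap.fst ℝ _ _) -
    (innerₗ (TimeSpace d)).compl₁₂ (LinearMap.fst ℝ _ _) (LinearMap.snd ℝ _ _)

theorem symplecticForm_apply (l z : TFPlane d) :
    symplecticForm d l z = inner ℝ l.2 z.1 - inner ℝ l.1 z.2 := rfl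

/-- The symplectic Fourier transform of a product of short-time Fourier transforms of shifted
Gaussians. -/
theorem integral_gaussStft_mul (w₁ z₁ w₂ z₂ z : TFPlane d) :
    ∫ l : TFPlane d, Complex.exp (2 * Real.pi * Complex.I * ((-symplecticForm d l z : ℝ) : ℂ)) *
      (gaussStft w₁ z₁ l * conj (gaussStft w₂ z₂ l)) =
    gaussStft w₁ w₂ z * conj (gaussStft z₁ z₂ z) := by
  -- The total exponent is quadratic in `l`: `A` and `B` are the linear coefficients in `l.1` and
  -- `l.2`, and `D` is the constant term. The two factors of rate `π / 2` add up to `-π |l|²`, so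
  -- the Gaussian integrals have prefactor 1.
  let A : Fin d → ℂ := fun i => Real.pi * ((z₁.1 i - w₁.1 i + z₂.1 i - w₂.1 i) +
    Complex.I * (z₁.2 i + w₁.2 i - z₂.2 i - w₂.2 i)) + 2 * Real.pi * Complex.I * z.2 i
  let B : Fin d → ℂ := fun i => Real.pi * ((z₁.2 i - w₁.2 i + z₂.2 i - w₂.2 i) +
    Complex.I * (z₂.1 i + w₂.1 i - z₁.1 i - w₁.1 i)) - 2 * Real.pi * Complex.I * z.1 i
  let D : Fin d → ℂ := fun i =>
    Real.pi / 2 * ((z₁.1 i + w₁.1 i) + Complex.I * (z₁.2 i - w₁.2 i)) ^ 2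
      - Real.pi * (z₁.1 i) ^ 2 - Real.pi * (w₁.1 i) ^ 2
      + Real.pi / 2 * ((z₂.1 i + w₂.1 i) - Complex.I * (z₂.2 i - w₂.2 i)) ^ 2
      - Real.pi * (z₂.1 i) ^ 2 - Real.pi * (w₂.1 i) ^ 2
  set κ : ℂ := (1 / 2 : ℂ) ^ (d / 2 : ℂ)
  have h : ∀ l : TFPlane d,
      Complex.exp (2 * Real.pi * Complex.I * ((-symplecticForm d l z : ℝ) : ℂ)) *
        (gaussStft w₁ z₁ l * conj (gaussStft w₂ z₂ l)) =
      (κ * conj κ * Complex.exp (∑ i, D i)) *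
        (Complex.exp (-Real.pi * ∑ i, (l.1 i : ℂ) ^ 2 + ∑ i, A i * l.1 i) *
         Complex.exp (-Real.pi * ∑ i, (l.2 i : ℂ) ^ 2 + ∑ i, B i * l.2 i)) := by
    intro l
    simp only [gaussStft_eq, map_mul, ← Complex.exp_conj]
    have : ∀ a b c e f g k : ℂ, Complex.exp a * (k * Complex.exp b * (g * Complex.exp c)) =
        k * g * Complex.exp (a + b + c) := fun a b c e f g k => by
      rw [Complex.exp_add, Complex.exp_add]; ring
    rw [this _ _ _ 0 0, mul_assoc _ (Complex.exp _), ← Complex.exp_add, ← Complex.exp_add]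
    congr 2
    rw [symplecticForm_apply, Complex.ofReal_neg, Complex.ofReal_sub, ofReal_inner_eq_sum,
      ofReal_inner_eq_sum]
    simp only [map_sum, Finset.mul_sum, ← Finset.sum_add_distrib, ← Finset.sum_sub_distrib,
      ← Finset.sum_neg_distrib]
    refine Finset.sum_congr rfl fun i _ => ?_
    simp only [stftExponent, A, B, D, map_add, map_sub, map_mul, map_pow, map_div₀,
      Complex.conj_ofReal, Complex.conj_I, map_ofNat]
    ring_nf
    simp only [Complex.I_sq]
    ring
  have hπ : 0 < (Real.pi : ℂ).re := by simp [Real.pi_pos]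
  have hpi : (Real.pi : ℂ) ≠ 0 := Complex.ofReal_ne_zero.2 Real.pi_ne_zero
  simp only [h]
  rw [integral_const_mul, Measure.volume_eq_prod, integral_prod_mul
    (f := fun x : TimeSpace d => Complex.exp (-Real.pi * ∑ i, (x i : ℂ) ^ 2 + ∑ i, A i * x i))
    (g := fun x : TimeSpace d => Complex.exp (-Real.pi * ∑ i, (x i : ℂ) ^ 2 + ∑ i, B i * x i)),
    integral_cexp_neg_mul_sum_add_timeSpace hπ, integral_cexp_neg_mul_sum_add_timeSpace hπ,
    div_self hpi, Complex.one_cpow, one_mul, one_mul, mul_assoc, ← Complex.exp_add,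
    ← Complex.exp_add]
  simp only [gaussStft_eq, map_mul, ← Complex.exp_conj]
  rw [mul_mul_mul_comm, ← Complex.exp_add]
  congr 2
  simp only [map_sum, Finset.sum_div, ← Finset.sum_add_distrib]
  refine Finset.sum_congr rfl fun i _ => ?_
  simp only [stftExponent, A, B, D, map_add, map_sub, map_mul, map_pow, map_div₀,
      Complex.conj_ofReal, Complex.conj_I, map_ofNat]
  field_simp
  ring_nf
  simp only [Complex.I_sq]
  ring

end Gaussian

/-! ### The adjoint lattice as symplectic dual. -/

section AdjointLattice

variable {d : ℕ}

theorem continuous_stdGaussian : Continuous (stdGaussian : TimeSpace d → ℂ) := by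
  unfold stdGaussian; fun_prop

theorem stdGaussian_eq (t : TimeSpace d) :
    stdGaussian t = ((Real.exp (-Real.pi * ‖t‖ ^ 2) : ℝ) : ℂ) := by
  rw [stdGaussian, EuclideanSpace.real_norm_sq_eq]
  push_cast
  rfl

theorem norm_stdGaussian_le_one (t : TimeSpace d) : ‖stdGaussian t‖ ≤ 1 := by
  rw [stdGaussian_eq, Complex.norm_real, Real.norm_of_nonneg (Real.exp_pos _).le,
    Real.exp_le_one_iff]
  nlinarith [Real.pi_pos, sq_nonneg ‖t‖]

theorem integrable_stdGaussian : Integrable (stdGaussian : TimeSpace d → ℂ) := by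
  have h := GaussianFourier.integrable_cexp_neg_mul_sq_norm_add (V := TimeSpace d) (b := Real.pi)
    (by simp [Real.pi_pos]) 0 0
  refine h.congr (.of_forall fun t => ?_)
  simp [stdGaussian_eq]

theorem tfShift_tfShift (l z : TFPlane d) (h : TimeSpace d → ℂ) (t : TimeSpace d) :
    tfShift l (tfShift z h) t =
      Complex.exp (-2 * Real.pi * Complex.I * ((inner ℝ z.2 l.1 : ℝ) : ℂ)) *
        (Complex.exp (2 * Real.pi * Complex.I * ((inner ℝ (l.2 + z.2) t : ℝ) : ℂ)) *
          h (t - (l.1 + z.1))) := by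
  simp only [tfShift, ← mul_assoc, ← Complex.exp_add]
  rw [sub_sub]
  congr 2
  rw [inner_sub_right, inner_add_left]
  push_cast
  ring

/-- Composing two shifts in either order gives the same shift up to a phase; the phases agree
exactly when the symplectic form is an integer. -/
theorem mem_adjointLattice_iff (Λ : Set (TFPlane d)) (z : TFPlane d) :
    z ∈ adjointLattice Λ ↔ ∀ l ∈ Λ, ∃ k : ℤ, symplecticForm d l z = k := by
  refine forall₂_congr fun l _ => ?_
  have hexp : (∃ k : ℤ, symplecticForm d l z = k) ↔
      Complex.exp (-2 * Real.pi * Complex.I * ((inner ℝ z.2 l.1 : ℝ) : ℂ)) =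
      Complex.exp (-2 * Real.pi * Complex.I * ((inner ℝ l.2 z.1 : ℝ) : ℂ)) := by
    rw [Complex.exp_eq_exp_iff_exists_int]
    refine exists_congr fun k => ?_
    rw [symplecticForm_apply, real_inner_comm z.2 l.1, ← Complex.ofReal_inj]
    have h0 : (2 * Real.pi * Complex.I : ℂ) ≠ 0 := Complex.two_pi_I_ne_zero
    constructor
    · intro h
      push_cast at h
      linear_combination (2 * Real.pi * Complex.I : ℂ) * h
    · intro h
      apply mul_left_cancel₀ h0
      push_cast
      linear_combination h
  rw [hexp]
  constructor
  · intro H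
    have hm : MemLp (stdGaussian : TimeSpace d → ℂ) 2 := by
      have hc : Continuous (stdGaussian : TimeSpace d → ℂ) := continuous_stdGaussian
      rw [memLp_two_iff_integrable_sq_norm hc.aestronglyMeasurable]
      refine (integrable_stdGaussian.norm).mono' (by fun_prop) (.of_forall fun t => ?_)
      rw [Real.norm_of_nonneg (by positivity), pow_two]
      exact mul_le_of_le_one_left (norm_nonneg _) (norm_stdGaussian_le_one t)
    -- One point of one test function suffices, since the Gaussian vanishes nowhere and can be
    -- cancelled.
    obtain ⟨t, ht⟩ := (H _ hm).exists
    rw [tfShift_tfShift, tfShift_tfShift, add_comm z.2, add_comm z.1] at ht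
    refine mul_right_cancel₀ ?_ ht
    exact mul_ne_zero (Complex.exp_ne_zero _) (Complex.exp_ne_zero _)
  · intro H h _
    refine .of_forall fun t => ?_
    rw [tfShift_tfShift, tfShift_tfShift, add_comm z.2, add_comm z.1, H]

variable {ι : Type*} [Fintype ι]

/-- Coordinates of a point with respect to the symplectic dual of a basis. -/
def symplecticCoord (B : Module.Basis ι ℝ (TFPlane d)) : TFPlane d →ₗ[ℝ] (ι → ℝ) :=
  LinearMap.pi fun i => symplecticForm d (B i)

theorem symplecticForm_basis_sum (B : Module.Basis ι ℝ (TFPlane d)) (x : ι → ℝ) (z : TFPlane d) :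
    symplecticForm d (∑ i, x i • B i) z = ∑ i, x i * symplecticCoord B z i := by
  simp [symplecticCoord]

theorem symplecticCoord_injective (B : Module.Basis ι ℝ (TFPlane d)) :
    Function.Injective (symplecticCoord B) := by
  rw [← LinearMap.ker_eq_bot, LinearMap.ker_eq_bot']
  intro z hz
  have h : ∀ l, symplecticForm d l z = 0 := fun l => by
    rw [← B.sum_equivFun l, symplecticForm_basis_sum, hz]
    simp
  -- These two test vectors produce `‖z.1‖²` and `‖z.2‖²`, so the form is nondegenerate.
  have h1 := h (0, z.1)
  have h2 := h (-z.2, 0)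
  simp [symplecticForm_apply] at h1 h2
  exact Prod.ext h1 h2

/-- The basis that is dual to a given one with respect to the symplectic form. -/
def symplecticDualBasis (B : Module.Basis ι ℝ (TFPlane d)) : Module.Basis ι ℝ (TFPlane d) :=
  Module.Basis.ofEquivFun ((symplecticCoord B).linearEquivOfInjective
    (symplecticCoord_injective B) (by simp [Module.finrank_eq_card_basis B]))

theorem symplecticCoord_dualBasis_sum (B : Module.Basis ι ℝ (TFPlane d)) (x : ι → ℝ) :
    symplecticCoord B (∑ i, x i • symplecticDualBasis B i) = x := by
  rw [← Module.Basis.equivFun_symm_apply, symplecticDualBasis, Module.Basis.equivFun_ofEquivFun]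
  exact LinearEquiv.apply_symm_apply
    ((symplecticCoord B).linearEquivOfInjective (symplecticCoord_injective B) _) x

variable (Λ : Submodule ℤ (TFPlane d)) [DiscreteTopology Λ] [IsZLattice ℝ Λ]
  (b : Module.Basis ι ℤ Λ)

theorem coe_equivFun_symm_ofZLatticeBasis (n : ι → ℤ) :
    ((b.equivFun.symm n : Λ) : TFPlane d) = ∑ i, (n i : ℝ) • b.ofZLatticeBasis ℝ Λ i := by
  simp [Module.Basis.equivFun_symm_apply, Int.cast_smul_eq_zsmul]

/-- The adjoint lattice is parametrized by integer coordinates in the dual basis. -/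
def adjointLatticeEquiv : (ι → ℤ) ≃ adjointLattice (Λ : Set (TFPlane d)) :=
  Equiv.ofBijective (fun n => ⟨∑ i, (n i : ℝ) • symplecticDualBasis (b.ofZLatticeBasis ℝ Λ) i, by
    rw [mem_adjointLattice_iff]
    intro l hl
    refine ⟨∑ i, b.equivFun ⟨l, hl⟩ i * n i, ?_⟩
    have : l = ∑ i, (b.equivFun ⟨l, hl⟩ i : ℝ) • b.ofZLatticeBasis ℝ Λ i := by
      rw [← coe_equivFun_symm_ofZLatticeBasis, LinearEquiv.symm_apply_apply]
    conv_lhs => rw [this]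
    rw [symplecticForm_basis_sum, symplecticCoord_dualBasis_sum]
    push_cast
    rfl⟩) (by
  constructor
  · intro m n h
    have h1 := congrArg (symplecticCoord (b.ofZLatticeBasis ℝ Λ)) (Subtype.ext_iff.1 h)
    simp only [symplecticCoord_dualBasis_sum] at h1
    ext i
    exact_mod_cast congrFun h1 i
  · rintro ⟨z, hz⟩
    rw [mem_adjointLattice_iff] at hz
    -- Integrality against the basis of `Λ` alone provides the integer coordinates, and the
    -- coordinates determine the point.
    choose n hn using fun i => hz (b i) (b i).2
    refine ⟨n, Subtype.ext (symplecticCoord_injective (b.ofZLatticeBasis ℝ Λ) ?_)⟩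
    rw [symplecticCoord_dualBasis_sum]
    ext i
    simp [symplecticCoord, hn])

theorem coe_adjointLatticeEquiv (n : ι → ℤ) :
    (adjointLatticeEquiv Λ b n : TFPlane d) =
      ∑ i, (n i : ℝ) • symplecticDualBasis (b.ofZLatticeBasis ℝ Λ) i := rfl

instance countable_adjointLattice : Countable (adjointLattice (Λ : Set (TFPlane d))) :=
  (adjointLatticeEquiv Λ (Module.Free.chooseBasis ℤ Λ)).symm.injective.countable

end AdjointLattice

/-! ### The identity for shifted Gaussians. -/

section GaussianIdentity

/-- Equivalence of norms in finite dimension. It transfers Gaussian decay on the plane to lattice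
coordinates, as Poisson summation requires. -/
theorem exists_mul_norm_le_norm_sum_smul {ι V : Type*} [Fintype ι] [NormedAddCommGroup V]
    [NormedSpace ℝ V] (B : Module.Basis ι ℝ V) :
    ∃ δ : ℝ, 0 < δ ∧ ∀ x : ι → ℝ, δ * ‖x‖ ≤ ‖∑ i, x i • B i‖ := by
  have : FiniteDimensional ℝ V := B.finiteDimensional_of_finite
  obtain ⟨K, hK, hK'⟩ :=
    B.equivFun.toContinuousLinearEquiv.toContinuousLinearMap.isBoundedLinearMap.bound
  refine ⟨K⁻¹, inv_pos.2 hK, fun x => ?_⟩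
  rw [inv_mul_le_iff₀ hK]
  refine le_trans (le_of_eq ?_) (hK' _)
  congr 1
  rw [← B.equivFun_symm_apply]
  exact (LinearEquiv.apply_symm_apply B.equivFun x).symm

variable {d : ℕ} {α ι : Type*} [Fintype ι]

/-- Uniform summability of products of short-time Fourier transforms of shifted Gaussians over
a lattice. -/
theorem exists_tsum_norm_gaussStft_le (B : Module.Basis ι ℝ (TFPlane d)) (p : α → TFPlane d)
    (e : (ι → ℤ) ≃ α) (he : ∀ n, p (e n) = ∑ i, (n i : ℝ) • B i) :
    ∃ C : ℝ, ∀ w₁ z₁ w₂ z₂ : TFPlane d,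
      Summable (fun x => ‖gaussStft w₁ z₁ (p x) * conj (gaussStft w₂ z₂ (p x))‖) ∧
      ∑' x, ‖gaussStft w₁ z₁ (p x) * conj (gaussStft w₂ z₂ (p x))‖ ≤ C := by
  obtain ⟨C, hC⟩ := exists_tsum_exp_neg_mul_norm_sub_sq_le B (a := Real.pi / 2) (by positivity)
  refine ⟨C, fun w₁ z₁ w₂ z₂ => ?_⟩
  obtain ⟨h1, h2⟩ := hC (w₁ - z₁)
  -- The decay of the first factor is enough; the second is merely bounded by 1.
  have key : ∀ n : ι → ℤ, ‖gaussStft w₁ z₁ (p (e n)) * conj (gaussStft w₂ z₂ (p (e n)))‖ ≤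
      Real.exp (-(Real.pi / 2) * ‖(∑ i, (n i : ℝ) • B i) + (w₁ - z₁)‖ ^ 2) := fun n => by
    rw [norm_mul, RCLike.norm_conj, ← he]
    exact (mul_le_of_le_one_right (norm_nonneg _) (norm_gaussStft_le_one _ _ _)).trans
      (norm_gaussStft_le _ _ _)
  have hs := Summable.of_nonneg_of_le (fun n => norm_nonneg _) key h1
  refine ⟨e.summable_iff.1 hs, ?_⟩
  rw [← e.tsum_eq]
  exact (hs.tsum_le_tsum key h1).trans h2

variable (Λ : Submodule ℤ (TFPlane d)) [DiscreteTopology Λ] [IsZLattice ℝ Λ]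

/-- The fundamental identity of Gabor analysis for shifted Gaussians. -/
theorem tsum_gaussStft_mul (b : Module.Basis ι ℤ Λ) (w₁ z₁ w₂ z₂ : TFPlane d) :
    ∑' l : Λ, gaussStft w₁ z₁ l * conj (gaussStft w₂ z₂ l) =
      ((ZLattice.covolume Λ volume : ℝ) : ℂ)⁻¹ * ∑' z : adjointLattice (Λ : Set (TFPlane d)),
        gaussStft w₁ w₂ z * conj (gaussStft z₁ z₂ z) := by
  obtain ⟨B, hB⟩ : ∃ B, B = b.ofZLatticeBasis ℝ Λ := ⟨_, rfl⟩
  let f : (ι → ℝ) → ℂ := fun x =>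
    gaussStft w₁ z₁ (∑ i, x i • B i) * conj (gaussStft w₂ z₂ (∑ i, x i • B i))
  have hf : Continuous f := by
    have h1 := continuous_gaussStft_right w₁ z₁
    have h2 := continuous_gaussStft_right w₂ z₂
    fun_prop
  -- In lattice coordinates the frequency `n` pairs with `x` as the symplectic form pairs the
  -- lattice vector with the adjoint point of index `n`. The Fourier coefficient is thus a
  -- symplectic Fourier transform, divided by the covolume.
  have hcoef : ∀ n : ι → ℤ,
      ∫ x, Complex.exp (2 * Real.pi * Complex.I * ((∑ i, ((-n) i : ℝ) * x i : ℝ) : ℂ)) * f x =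
      ((ZLattice.covolume Λ volume : ℝ) : ℂ)⁻¹ *
        (gaussStft w₁ w₂ (adjointLatticeEquiv Λ b n) *
          conj (gaussStft z₁ z₂ (adjointLatticeEquiv Λ b n))) := by
    intro n
    rw [← integral_gaussStft_mul, ← integral_comp_ofZLatticeBasis volume Λ b]
    congr 1
    ext x
    rw [symplecticForm_basis_sum, coe_adjointLatticeEquiv, symplecticCoord_dualBasis_sum]
    simp only [f, hB, ← Finset.sum_neg_distrib]
    congr 4
    refine Finset.sum_congr rfl fun i _ => ?_
    simp [mul_comm]
  obtain ⟨C', hC'⟩ := exists_tsum_norm_gaussStft_le (symplecticDualBasis (b.ofZLatticeBasis ℝ Λ))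
    (fun z : adjointLattice (Λ : Set (TFPlane d)) => (z : TFPlane d)) (adjointLatticeEquiv Λ b)
    (coe_adjointLatticeEquiv Λ b)
  have hsum := (hC' w₁ w₂ z₁ z₂).1.of_norm
  obtain ⟨δ, hδ, hBδ⟩ := exists_mul_norm_le_norm_sum_smul B
  have hpos := Real.pi_pos
  have hb : ∀ x, ‖f x‖ ≤ Real.exp (Real.pi / 2 * ‖w₁ - z₁‖ ^ 2) *
      Real.exp (-(Real.pi / 4 * δ ^ 2) * ‖x‖ ^ 2) := by
    intro x
    simp only [f]
    rw [norm_mul, RCLike.norm_conj]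
    refine (mul_le_of_le_one_right (norm_nonneg _) (norm_gaussStft_le_one _ _ _)).trans
      ((norm_gaussStft_le _ _ _).trans ((exp_neg_mul_norm_add_sq_le (by positivity) _ _).trans ?_))
    refine mul_le_mul_of_nonneg_left (Real.exp_le_exp.2 ?_) (Real.exp_pos _).le
    have := pow_le_pow_left₀ (by positivity) (hBδ x) 2
    rw [mul_pow] at this
    nlinarith
  have hP := tsum_intVec_eq_tsum_fourier hf (by positivity) hb (by
    simp only [hcoef]
    exact ((adjointLatticeEquiv Λ b).summable_iff.2 hsum).mul_left _)
  simp only [hcoef] at hP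
  rw [tsum_mul_left, (adjointLatticeEquiv Λ b).tsum_eq
    (fun z => gaussStft w₁ w₂ z * conj (gaussStft z₁ z₂ z))] at hP
  rw [← hP, ← b.equivFun.symm.toEquiv.tsum_eq]
  refine tsum_congr fun n => ?_
  simp only [LinearEquiv.coe_toEquiv, coe_equivFun_symm_ofZLatticeBasis, f, intVec, hB]

end GaussianIdentity

/-! ### Inversion of the short-time Fourier transform and Gaussian superpositions. -/

section Inversion

open scoped FourierTransform ContDiff

variable {d : ℕ}

theorem norm_cexp_two_pi_I_mul (r : ℝ) : ‖Complex.exp (2 * Real.pi * Complex.I * (r : ℂ))‖ = 1 := by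
  rw [← Complex.norm_exp_ofReal_mul_I (2 * Real.pi * r)]
  congr 2
  push_cast
  ring

theorem norm_tfShift (z : TFPlane d) (h : TimeSpace d → ℂ) (t : TimeSpace d) :
    ‖tfShift z h t‖ = ‖h (t - z.1)‖ := by
  rw [tfShift, norm_mul, norm_cexp_two_pi_I_mul, one_mul]

theorem continuous_tfShift {h : TimeSpace d → ℂ} (hh : Continuous h) :
    Continuous fun p : TFPlane d × TimeSpace d => tfShift p.1 h p.2 := by
  unfold tfShift
  fun_prop

theorem continuous_tfShift_left {h : TimeSpace d → ℂ} (hh : Continuous h) (t : TimeSpace d) :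
    Continuous fun z : TFPlane d => tfShift z h t := by
  unfold tfShift
  fun_prop

theorem continuous_tfShift_right {h : TimeSpace d → ℂ} (hh : Continuous h) (z : TFPlane d) :
    Continuous (tfShift z h) := by
  unfold tfShift
  fun_prop

/-- A smooth bump equal to 1 near a point is a Schwartz function, and multiplying by it does not
change `f` there. -/
theorem locallyIntegrable_of_integrable_mul_schwartz {f : TimeSpace d → ℂ}
    (hf : ∀ φ : 𝓢(TimeSpace d, ℂ), Integrable fun t => f t * φ t) : LocallyIntegrable f := by
  intro x
  let β : ContDiffBump x := default
  have hc : HasCompactSupport fun t => ((β t : ℝ) : ℂ) :=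
    β.hasCompactSupport.comp_left (g := fun r : ℝ => (r : ℂ)) Complex.ofReal_zero
  have hs : ContDiff ℝ ∞ fun t => ((β t : ℝ) : ℂ) := Complex.ofRealCLM.contDiff.comp β.contDiff
  refine ⟨Metric.closedBall x β.rIn, Metric.closedBall_mem_nhds x β.rIn_pos, ?_⟩
  refine (hf (hc.toSchwartzMap hs)).integrableOn.congr_fun (fun t ht => ?_)
    Metric.isClosed_closedBall.measurableSet
  simp [β.one_of_mem_closedBall ht]

theorem integrable_mul_conj_schwartz_sub {f : TimeSpace d → ℂ}
    (hf : ∀ φ : 𝓢(TimeSpace d, ℂ), Integrable fun t => f t * φ t) (φ : 𝓢(TimeSpace d, ℂ))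
    (x : TimeSpace d) : Integrable fun t => f t * conj (φ (t - x)) := by
  have h := hf (φ.compSubConstCLM ℂ x)
  refine h.mono (((locallyIntegrable_of_integrable_mul_schwartz hf).aestronglyMeasurable).mul ?_) ?_
  · have := φ.continuous
    exact Continuous.aestronglyMeasurable (by fun_prop)
  · exact .of_forall fun t => by simp

/-- For fixed `x` the transform is an ordinary Fourier transform in the frequency variable, so
Parseval applies slice by slice. -/
theorem stft_eq_fourier (φ f : TimeSpace d → ℂ) (x w : TimeSpace d) :
    stft φ f (x, w) = 𝓕 (fun t => f t * conj (φ (t - x))) w := by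
  rw [Real.fourier_eq', stft]
  congr 1
  ext t
  simp only [tfShift, map_mul, ← Complex.exp_conj, Complex.conj_ofReal, Complex.conj_I, map_ofNat,
    smul_eq_mul, real_inner_comm t w]
  rw [mul_left_comm]
  congr 2
  push_cast
  ring

/-- Parseval's formula for an integrable function and a test function. -/
theorem integral_mul_eq_integral_fourier_mul_fourierInv {h s : TimeSpace d → ℂ} (hh : Integrable h)
    (hc : HasCompactSupport s) (hs : ContDiff ℝ ∞ s) :
    ∫ t, h t * s t = ∫ w, 𝓕 h w * 𝓕⁻ s w := by
  let S := hc.toSchwartzMap hs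
  have h1 := VectorFourier.integral_fourierIntegral_smul_eq_flip (L := innerₗ (TimeSpace d))
      Real.continuous_fourierChar continuous_inner hh ((𝓕⁻ S).integrable (μ := volume))
  have h2 : 𝓕 ((𝓕⁻ S : 𝓢(TimeSpace d, ℂ)) : TimeSpace d → ℂ) = s := by
    rw [← SchwartzMap.fourier_coe, FourierTransform.fourier_fourierInv_eq]
    rfl
  have h3 : ((𝓕⁻ S : 𝓢(TimeSpace d, ℂ)) : TimeSpace d → ℂ) = 𝓕⁻ s := by
    rw [SchwartzMap.fourierInv_coe]
    rfl
  rw [flip_innerₗ] at h1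
  change ∫ w, 𝓕 h w • ((𝓕⁻ S : 𝓢(TimeSpace d, ℂ)) w) = ∫ t, h t •
    𝓕 ((𝓕⁻ S : 𝓢(TimeSpace d, ℂ)) : TimeSpace d → ℂ) t at h1
  rw [h2, h3] at h1
  exact h1.symm

/-- Inversion formula for the short-time Fourier transform. -/
theorem ae_mul_integral_eq_integral_stft_mul_tfShift {f : TimeSpace d → ℂ}
    (hf : ∀ φ : 𝓢(TimeSpace d, ℂ), Integrable fun t => f t * φ t) (φ : 𝓢(TimeSpace d, ℂ))
    (hV : Integrable (stft φ f)) {ψ : TimeSpace d → ℂ} (hψ : ContDiff ℝ ∞ ψ)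
    (hψb : ∀ t, ‖ψ t‖ ≤ 1) :
    ∀ᵐ t, f t * (∫ y, conj (φ y) * ψ y) = ∫ z, stft φ f z * tfShift z ψ t := by
  have hcont := continuous_tfShift hψ.continuous
  have hloc := locallyIntegrable_of_integrable_mul_schwartz hf
  have hφc := φ.continuous
  have hψc := hψ.continuous
  have hk : Integrable fun y => conj (φ y) * ψ y := by
    refine φ.integrable.norm.mono' (by fun_prop) (.of_forall fun y => ?_)
    rw [norm_mul, RCLike.norm_conj]
    exact mul_le_of_le_one_right (norm_nonneg _) (hψb y)
  have hbd : ∀ (z : TFPlane d) (t : TimeSpace d), ‖tfShift z ψ t‖ ≤ 1 := fun z t => by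
    rw [norm_tfShift]; exact hψb _
  -- Both sides are tested against compactly supported smooth `θ`. The cutoff supplies the decay, so
  -- `ψ` may be any bounded smooth function.
  refine ae_eq_of_integral_contDiff_smul_eq ?_ ?_ fun θ hθ hθc => ?_
  · have : (fun t => f t * ∫ y, conj (φ y) * ψ y) = (∫ y, conj (φ y) * ψ y) • f := by
      ext t; simp [mul_comm]
    rw [this]
    exact hloc.smul _
  · refine Continuous.locallyIntegrable (continuous_of_dominated
      (bound := fun z => ‖stft φ f z‖) (fun t => ?_) (fun t => .of_forall fun z => ?_) hV.norm
      (.of_forall fun z => ?_))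
    · exact hV.aestronglyMeasurable.mul
        (continuous_tfShift_left hψc t).aestronglyMeasurable
    · rw [norm_mul]
      exact mul_le_of_le_one_right (norm_nonneg _) (hbd z t)
    · exact continuous_const.mul (continuous_tfShift_right hψc z)
  let Θ : TimeSpace d → ℂ := fun t => θ t
  have hΘ : ContDiff ℝ ∞ Θ := Complex.ofRealCLM.contDiff.comp hθ
  have hΘc : HasCompactSupport Θ :=
    hθc.comp_left (g := fun r : ℝ => (r : ℂ)) Complex.ofReal_zero
  have hΘi : Integrable Θ := hΘ.continuous.integrable_of_hasCompactSupport hΘc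
  have hfΘ : Integrable fun t => f t * Θ t := hf (hΘc.toSchwartzMap hΘ)
  -- This is the convolution integrand of `f Θ` with the reflection of `conj φ · ψ`, both
  -- integrable.
  have hswap1 : Integrable (fun p : TimeSpace d × TimeSpace d =>
      (f p.2 * Θ p.2) * (conj (φ (p.2 - p.1)) * ψ (p.2 - p.1))) := by
    have := hfΘ.convolution_integrand (ContinuousLinearMap.mul ℂ ℂ) hk.comp_neg
    simpa using! this
  have hprod : Integrable (fun p : TFPlane d × TimeSpace d =>
      (stft φ f p.1 * Θ p.2) * tfShift p.1 ψ p.2) :=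
    (hV.mul_prod hΘi).mul_bdd (c := 1) hcont.aestronglyMeasurable
      (.of_forall fun p => hbd p.1 p.2)
  have hinner : ∀ x : TimeSpace d,
      ∫ t, (f t * Θ t) * (conj (φ (t - x)) * ψ (t - x)) =
      ∫ w, stft φ f (x, w) * ∫ t, Θ t * tfShift (x, w) ψ t := by
    intro x
    have hs : ContDiff ℝ ∞ fun t => Θ t * ψ (t - x) := by fun_prop
    have h := integral_mul_eq_integral_fourier_mul_fourierInv
      (integrable_mul_conj_schwartz_sub hf φ x) (s := fun t => Θ t * ψ (t - x)) hΘc.mul_right hs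
    calc _ = ∫ t, (f t * conj (φ (t - x))) * (Θ t * ψ (t - x)) := by
          congr 1; ext t; ring
      _ = _ := h
      _ = _ := by
          congr 1
          ext w
          rw [stft_eq_fourier, Real.fourierInv_eq']
          congr 2
          ext t
          simp only [tfShift, smul_eq_mul, real_inner_comm t w]
          rw [mul_left_comm]
          congr 3
          push_cast
          ring
  calc ∫ t, θ t • (f t * ∫ y, conj (φ y) * ψ y)
      = ∫ t, ∫ x, (f t * Θ t) * (conj (φ (t - x)) * ψ (t - x)) := by
        congr 1
        ext t
        rw [integral_const_mul, integral_sub_left_eq_self (fun y => conj (φ y) * ψ y) volume t,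
          Complex.real_smul]
        ring
    _ = ∫ x, ∫ t, (f t * Θ t) * (conj (φ (t - x)) * ψ (t - x)) :=
        (integral_integral_swap hswap1).symm
    _ = ∫ x, ∫ w, stft φ f (x, w) * ∫ t, Θ t * tfShift (x, w) ψ t := by simp only [hinner]
    _ = ∫ z : TFPlane d, stft φ f z * ∫ t, Θ t * tfShift z ψ t := by
        have := hprod.integral_prod_left
        simp only [mul_assoc, integral_const_mul] at this
        exact (integral_prod _ this).symm
    _ = ∫ z : TFPlane d, ∫ t, (stft φ f z * Θ t) * tfShift z ψ t := by
        simp only [mul_assoc, integral_const_mul]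
    _ = ∫ t, ∫ z : TFPlane d, (stft φ f z * Θ t) * tfShift z ψ t :=
        integral_integral_swap hprod
    _ = _ := by
        congr 1
        ext t
        rw [Complex.real_smul, ← integral_const_mul]
        congr 1
        ext z
        ring

theorem contDiff_stdGaussian : ContDiff ℝ ∞ (stdGaussian : TimeSpace d → ℂ) := by
  have : (stdGaussian : TimeSpace d → ℂ) =
      fun t => ((Real.exp (-Real.pi * ‖t‖ ^ 2) : ℝ) : ℂ) := funext stdGaussian_eq
  rw [this]
  exact Complex.ofRealCLM.contDiff.comp
    (Real.contDiff_exp.comp (contDiff_const.mul (contDiff_norm_sq ℝ)))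

/-- The inversion formula must be divided by this pairing, which may vanish for the unmodulated
Gaussian. If it vanished for every modulation, `conj φ` times the Gaussian would have zero Fourier
transform, hence be zero, and the Gaussian has no zeros. -/
theorem exists_integral_conj_schwartz_mul_tfShift_ne_zero {φ : 𝓢(TimeSpace d, ℂ)} (hφ : φ ≠ 0) :
    ∃ w : TimeSpace d, ∫ y, conj (φ y) * tfShift (0, w) stdGaussian y ≠ 0 := by
  by_contra! H
  apply hφ
  have hφc := φ.continuous
  have hGc := continuous_stdGaussian (d := d)
  let g : TimeSpace d → ℂ := fun y => conj (φ y) * stdGaussian y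
  have hg : Integrable g := by
    refine φ.integrable.norm.mono' (by fun_prop) (.of_forall fun y => ?_)
    rw [norm_mul, RCLike.norm_conj]
    exact mul_le_of_le_one_right (norm_nonneg _) (norm_stdGaussian_le_one y)
  have hF : 𝓕 g = 0 := by
    ext w
    rw [Pi.zero_apply, ← H (-w), Real.fourier_eq']
    congr 1
    ext y
    simp only [tfShift, smul_eq_mul, g, sub_zero, inner_neg_left, real_inner_comm y w]
    rw [mul_left_comm]
    congr 3
    push_cast
    ring
  have hinv := (by fun_prop : Continuous g).fourierInv_fourier_eq hg
    (by rw [hF]; exact integrable_zero _ _ _)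
  rw [hF] at hinv
  ext y
  have h0 : g y = 0 := by
    rw [← hinv, Real.fourierInv_eq']
    simp
  have hne : stdGaussian y ≠ 0 := Complex.exp_ne_zero _
  simpa [g, hne] using h0

/-- Every element of Feichtinger's algebra is an `L¹` superposition of time-frequency shifts of the
Gaussian. -/
theorem MemFeichtingerAlgebra.exists_ae_eq_integral_tfShift {f : TimeSpace d → ℂ}
    (hf : MemFeichtingerAlgebra f) :
    ∃ c : TFPlane d → ℂ, Integrable c ∧ f =ᵐ[volume] fun t => ∫ z, c z * tfShift z stdGaussian t := by
  obtain ⟨φ, hφ, hV⟩ := hf.exists_window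
  obtain ⟨w, hw⟩ := exists_integral_conj_schwartz_mul_tfShift_ne_zero hφ
  have hψ : ContDiff ℝ ∞ (tfShift (0, w) (stdGaussian : TimeSpace d → ℂ)) := by
    have h1 := contDiff_stdGaussian (d := d)
    have h2 : ContDiff ℝ ∞ fun t : TimeSpace d => ((inner ℝ w t : ℝ) : ℂ) :=
      Complex.ofRealCLM.contDiff.comp (contDiff_const.inner ℝ contDiff_id)
    unfold tfShift
    fun_prop
  have key := ae_mul_integral_eq_integral_stft_mul_tfShift hf.integrable_mul_schwartz φ hV hψ
    (fun t => by rw [norm_tfShift]; exact norm_stdGaussian_le_one _)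
  set κ := ∫ y, conj (φ y) * tfShift (0, w) stdGaussian y
  -- Shifting a modulated Gaussian by `z` is shifting the Gaussian by `z + (0, w)` up to a phase.
  -- Translating by `(0, w)` and multiplying by the phase `m` moves the modulation into the
  -- coefficient.
  let m : TFPlane d → ℂ := fun z =>
    Complex.exp (2 * Real.pi * Complex.I * ((-inner ℝ w z.1 : ℝ) : ℂ))
  let c : TFPlane d → ℂ := fun z => κ⁻¹ * (stft φ f (z - (0, w)) * m z)
  have hm : Continuous m := by fun_prop
  refine ⟨c, ((hV.comp_sub_right (0, w)).mul_bdd (c := 1) hm.aestronglyMeasurable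
    (.of_forall fun z => (norm_cexp_two_pi_I_mul _).le)).const_mul _, ?_⟩
  filter_upwards [key] with t ht
  rw [← integral_add_right_eq_self _ ((0, w) : TFPlane d)]
  rw [eq_comm, ← mul_left_inj' hw, ht, ← integral_mul_const]
  congr 1
  ext z
  simp only [c, m, tfShift, add_sub_cancel_right, Prod.fst_add, Prod.snd_add, add_zero, sub_zero]
  have : Complex.exp (2 * Real.pi * Complex.I * ((inner ℝ z.2 t : ℝ) : ℂ)) *
      Complex.exp (2 * Real.pi * Complex.I * ((inner ℝ w (t - z.1) : ℝ) : ℂ)) =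
      Complex.exp (2 * Real.pi * Complex.I * ((-inner ℝ w z.1 : ℝ) : ℂ)) *
      Complex.exp (2 * Real.pi * Complex.I * ((inner ℝ (z.2 + w) t : ℝ) : ℂ)) := by
    rw [← Complex.exp_add, ← Complex.exp_add, inner_sub_right, inner_add_left]
    congr 1
    push_cast
    ring
  rw [← mul_assoc (Complex.exp (2 * Real.pi * Complex.I * ((inner ℝ z.2 t : ℝ) : ℂ))), this]
  field_simp

end Inversion

/-! ### Passing from Gaussians to superpositions. -/

section Superposition

set_option synthInstance.maxSize 1024

variable {d : ℕ}

theorem integrable_conj {X : Type*} [MeasurableSpace X] {μ : Measure X} {u : X → ℂ}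
    (hu : Integrable u μ) : Integrable (fun x => conj (u x)) μ :=
  hu.mono (Complex.continuous_conj.comp_aestronglyMeasurable hu.aestronglyMeasurable)
    (.of_forall fun _ => (RCLike.norm_conj _).le)

/-- The short-time Fourier transform of superpositions of shifted Gaussians. -/
theorem stft_eq_integral_gaussStft {f g : TimeSpace d → ℂ} {c e : TFPlane d → ℂ}
    (hc : Integrable c) (he : Integrable e)
    (hf : f =ᵐ[volume] fun t => ∫ z, c z * tfShift z stdGaussian t)
    (hg : g =ᵐ[volume] fun t => ∫ z, e z * tfShift z stdGaussian t) (l : TFPlane d) :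
    stft g f l = ∫ p : TFPlane d × TFPlane d, (c p.1 * conj (e p.2)) * gaussStft p.2 p.1 l := by
  have hce : Integrable (fun p : TFPlane d × TFPlane d => c p.1 * conj (e p.2)) :=
    hc.mul_prod (integrable_conj he)
  have h1 : Integrable (fun q : (TFPlane d × TFPlane d) × TimeSpace d =>
      (c q.1.1 * conj (e q.1.2)) * tfShift q.1.1 stdGaussian q.2) := by
    have hm : Continuous fun q : (TFPlane d × TFPlane d) × TimeSpace d =>
        tfShift q.1.1 stdGaussian q.2 := by
      have := continuous_stdGaussian (d := d)
      unfold tfShift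
      fun_prop
    have hm' : AEStronglyMeasurable (fun q : (TFPlane d × TFPlane d) × TimeSpace d =>
        (c q.1.1 * conj (e q.1.2)) * tfShift q.1.1 stdGaussian q.2) (volume.prod volume) :=
      hce.aestronglyMeasurable.comp_fst.mul hm.aestronglyMeasurable
    refine (integrable_prod_iff hm').2 ⟨.of_forall fun p => ?_, ?_⟩
    · have h : Integrable (tfShift p.1 stdGaussian) :=
        (integrable_stdGaussian.comp_sub_right p.1.1).mono
          (continuous_tfShift_right continuous_stdGaussian _).aestronglyMeasurable
          (.of_forall fun t => (norm_tfShift _ _ _).le)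
      exact h.const_mul (c p.1 * conj (e p.2))
    · simp only [norm_mul, norm_tfShift, integral_const_mul]
      have h (x : TimeSpace d) : ∫ t, ‖(stdGaussian (t - x) : ℂ)‖ = ∫ t : TimeSpace d,
          ‖stdGaussian t‖ := integral_sub_right_eq_self (fun t => ‖stdGaussian t‖) x
      simp only [h]
      simpa only [norm_mul] using hce.norm.mul_const _
  -- One Gaussian already gives integrability in `t`, with an `L¹` norm independent of the shift;
  -- the other only needs to be bounded.
  have h2 : Integrable (fun q : (TFPlane d × TFPlane d) × TimeSpace d =>
      (c q.1.1 * conj (e q.1.2)) * tfShift q.1.1 stdGaussian q.2 *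
        conj (tfShift l (tfShift q.1.2 stdGaussian) q.2)) := by
    refine h1.mul_bdd (c := 1) (Continuous.aestronglyMeasurable ?_) (.of_forall fun q => ?_)
    · have := continuous_stdGaussian (d := d)
      unfold tfShift
      fun_prop
    · rw [RCLike.norm_conj, norm_tfShift, norm_tfShift]
      exact norm_stdGaussian_le_one _
  have hg' : (fun t => g (t - l.1)) =ᵐ[volume]
      fun t => ∫ z, e z * tfShift z stdGaussian (t - l.1) :=
    (measurePreserving_sub_right volume l.1).quasiMeasurePreserving.ae_eq_comp hg
  calc stft g f l = ∫ t, ∫ p : TFPlane d × TFPlane d, (c p.1 * conj (e p.2)) *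
        tfShift p.1 stdGaussian t * conj (tfShift l (tfShift p.2 stdGaussian) t) := by
        refine integral_congr_ae ?_
        filter_upwards [hf, hg'] with t ht ht'
        rw [ht, tfShift, ht', map_mul, ← integral_conj, ← integral_const_mul]
        rw [Measure.volume_eq_prod, ← integral_prod_mul]
        congr 1
        ext p
        rw [tfShift.eq_def l, map_mul, map_mul]
        ring
    _ = ∫ p : TFPlane d × TFPlane d, ∫ t, (c p.1 * conj (e p.2)) *
        tfShift p.1 stdGaussian t * conj (tfShift l (tfShift p.2 stdGaussian) t) :=
        (integral_integral_swap h2).symm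
    _ = _ := by
        simp only [mul_assoc, integral_const_mul]
        simp only [gaussStft, stft]

/-- Products of short-time Fourier transforms of superpositions of shifted Gaussians. -/
theorem stft_mul_conj_stft_eq_integral {f₁ g₁ f₂ g₂ : TimeSpace d → ℂ}
    {c₁ e₁ c₂ e₂ : TFPlane d → ℂ} (hc₁ : Integrable c₁) (he₁ : Integrable e₁)
    (hc₂ : Integrable c₂) (he₂ : Integrable e₂)
    (hf₁ : f₁ =ᵐ[volume] fun t => ∫ z, c₁ z * tfShift z stdGaussian t)
    (hg₁ : g₁ =ᵐ[volume] fun t => ∫ z, e₁ z * tfShift z stdGaussian t)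
    (hf₂ : f₂ =ᵐ[volume] fun t => ∫ z, c₂ z * tfShift z stdGaussian t)
    (hg₂ : g₂ =ᵐ[volume] fun t => ∫ z, e₂ z * tfShift z stdGaussian t) (l : TFPlane d) :
    stft g₁ f₁ l * conj (stft g₂ f₂ l) =
      ∫ q : (TFPlane d × TFPlane d) × (TFPlane d × TFPlane d),
        ((c₁ q.1.1 * conj (e₁ q.1.2)) * conj (c₂ q.2.1 * conj (e₂ q.2.2))) *
          (gaussStft q.1.2 q.1.1 l * conj (gaussStft q.2.2 q.2.1 l)) := by
  rw [stft_eq_integral_gaussStft hc₁ he₁ hf₁ hg₁, stft_eq_integral_gaussStft hc₂ he₂ hf₂ hg₂,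
    ← integral_conj, ← integral_prod_mul]
  refine integral_congr_ae (.of_forall fun q => ?_)
  simp only [map_mul]
  ring

/-- The uniform bound gives `∑ₐ ∫ ‖C K_a‖ ≤ B ∫ ‖C‖`, so sum and integral may be exchanged. This
carries absolute convergence from Gaussians to `M^1`. -/
theorem summable_and_tsum_integral_mul {α Z : Type*} [Countable α] [MeasurableSpace Z]
    {μ : Measure Z} {C : Z → ℂ} (hC : Integrable C μ) {K : α → Z → ℂ}
    (hK : ∀ a, AEStronglyMeasurable (K a) μ) {B : ℝ}
    (hB : ∀ z, Summable (fun a => ‖K a z‖) ∧ ∑' a, ‖K a z‖ ≤ B) :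
    Summable (fun a => ‖∫ z, C z * K a z ∂μ‖) ∧
      ∑' a, ∫ z, C z * K a z ∂μ = ∫ z, C z * ∑' a, K a z ∂μ := by
  have hle : ∀ (s : Finset α) z, ∑ a ∈ s, ‖K a z‖ ≤ B := fun s z =>
    ((hB z).1.sum_le_tsum s fun _ _ => norm_nonneg _).trans (hB z).2
  have hint : ∀ a, Integrable (fun z => C z * K a z) μ := fun a =>
    hC.mul_bdd (hK a) (.of_forall fun z => by simpa using hle {a} z)
  have hsum : Summable fun a => ∫ z, ‖C z * K a z‖ ∂μ := by
    refine summable_of_sum_le (c := ∫ z, ‖C z‖ * B ∂μ)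
      (fun a => integral_nonneg fun z => norm_nonneg _) fun s => ?_
    rw [← integral_finsetSum s fun a _ => (hint a).norm]
    refine integral_mono (integrable_finsetSum s fun a _ => (hint a).norm)
      (hC.norm.mul_const B) fun z => ?_
    simp only [norm_mul, ← Finset.mul_sum]
    exact mul_le_mul_of_nonneg_left (hle s z) (norm_nonneg _)
  refine ⟨Summable.of_nonneg_of_le (fun a => norm_nonneg _)
    (fun a => norm_integral_le_integral_norm _) hsum, ?_⟩
  rw [integral_tsum_of_summable_integral_norm hint hsum]
  simp only [tsum_mul_left]

/-- The permutation `((a, b), (c, e)) ↦ ((e, b), (c, a))` of the factors of a fourfold product. -/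
def prodExchange (P : Type*) [MeasurableSpace P] : (P × P) × (P × P) ≃ᵐ (P × P) × (P × P) where
  toFun q := ((q.2.2, q.1.2), (q.2.1, q.1.1))
  invFun q := ((q.2.2, q.1.2), (q.2.1, q.1.1))
  left_inv _ := rfl
  right_inv _ := rfl
  measurable_toFun := by dsimp; fun_prop
  measurable_invFun := by dsimp; fun_prop

theorem measurePreserving_prodExchange {P : Type*} [MeasureSpace P] [SFinite (volume : Measure P)] :
    MeasurePreserving (prodExchange P) volume volume := by
  have sw : ∀ (A B : Type _) [MeasureSpace A] [MeasureSpace B] [SFinite (volume : Measure A)]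
      [SFinite (volume : Measure B)],
      MeasurePreserving (Prod.swap : A × B → B × A) volume volume :=
    fun _ _ => Measure.measurePreserving_swap
  have as : ∀ (A B C : Type _) [MeasureSpace A] [MeasureSpace B] [MeasureSpace C]
      [SFinite (volume : Measure A)] [SFinite (volume : Measure B)] [SFinite (volume : Measure C)],
      MeasurePreserving (MeasurableEquiv.prodAssoc : (A × B) × C ≃ᵐ A × B × C) volume volume :=
    fun _ _ _ => measurePreserving_prodAssoc _ _ _
  have idP := MeasurePreserving.id (volume : Measure P)
  have idPP := MeasurePreserving.id (volume : Measure (P × P))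
  have h1 := idPP.prod (sw P P)
  have h2 := as P P (P × P)
  have h3 := idP.prod ((as P P P).symm MeasurableEquiv.prodAssoc)
  have h4 := sw P ((P × P) × P)
  have h5 := as (P × P) P P
  -- Read from the right: `((a,b),(c,e))`, `((c,e),(a,b))`, `((c,e),(b,a))`, `(c,(e,(b,a)))`,
  -- `(c,((e,b),a))`, `(((e,b),a),c)`, `((e,b),(a,c))`, `((e,b),(c,a))`.
  exact h1.comp (h5.comp (h4.comp (h3.comp (h2.comp (h1.comp (sw (P × P) (P × P)))))))

end Superposition
end

/-! ### The identity on Feichtinger's algebra. -/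

set_option synthInstance.maxSize 1024

theorem mainTheorem2 (d : ℕ) (Λ : Submodule ℤ (TFPlane d)) [DiscreteTopology Λ] [IsZLattice ℝ Λ]
    (f₁ f₂ g₁ g₂ : TimeSpace d → ℂ)
    (hf₁ : MemFeichtingerAlgebra f₁) (hf₂ : MemFeichtingerAlgebra f₂)
    (hg₁ : MemFeichtingerAlgebra g₁) (hg₂ : MemFeichtingerAlgebra g₂) :
    Summable (fun l : Λ => ‖stft g₁ f₁ (l : TFPlane d) * conj (stft g₂ f₂ (l : TFPlane d))‖) ∧
    Summable (fun z : adjointLattice (Λ : Set (TFPlane d)) =>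
      ‖stft g₁ g₂ (z : TFPlane d) * conj (stft f₁ f₂ (z : TFPlane d))‖) ∧
    ∑' l : Λ, stft g₁ f₁ (l : TFPlane d) * conj (stft g₂ f₂ (l : TFPlane d)) =
      ((ZLattice.covolume Λ volume : ℝ) : ℂ)⁻¹ *
        ∑' z : adjointLattice (Λ : Set (TFPlane d)),
          stft g₁ g₂ (z : TFPlane d) * conj (stft f₁ f₂ (z : TFPlane d)) := by
  obtain ⟨c₁, hc₁, hf₁⟩ := hf₁.exists_ae_eq_integral_tfShift
  obtain ⟨c₂, hc₂, hf₂⟩ := hf₂.exists_ae_eq_integral_tfShift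
  obtain ⟨e₁, he₁, hg₁⟩ := hg₁.exists_ae_eq_integral_tfShift
  obtain ⟨e₂, he₂, hg₂⟩ := hg₂.exists_ae_eq_integral_tfShift
  have hint : ∀ {a b c e : TFPlane d → ℂ}, Integrable a → Integrable b → Integrable c →
      Integrable e → Integrable (fun q : (TFPlane d × TFPlane d) × (TFPlane d × TFPlane d) =>
        (a q.1.1 * conj (b q.1.2)) * conj (c q.2.1 * conj (e q.2.2))) := by
    intro a b c e ha hb hc he
    exact (ha.mul_prod (integrable_conj hb)).mul_prod
      (integrable_conj (hc.mul_prod (integrable_conj he)))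
  have hmeas : ∀ l : TFPlane d, AEStronglyMeasurable
      (fun q : (TFPlane d × TFPlane d) × (TFPlane d × TFPlane d) =>
        gaussStft q.1.2 q.1.1 l * conj (gaussStft q.2.2 q.2.1 l)) := by
    intro l
    refine Continuous.aestronglyMeasurable ?_
    have h1 := continuous_gaussStft.comp (by fun_prop : Continuous
      fun q : (TFPlane d × TFPlane d) × (TFPlane d × TFPlane d) => (q.1.2, q.1.1, l))
    have h2 := continuous_gaussStft.comp (by fun_prop : Continuous
      fun q : (TFPlane d × TFPlane d) × (TFPlane d × TFPlane d) => (q.2.2, q.2.1, l))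
    exact h1.mul (Complex.continuous_conj.comp h2)
  let b := Module.Free.chooseBasis ℤ Λ
  obtain ⟨B, hB⟩ := exists_tsum_norm_gaussStft_le (b.ofZLatticeBasis ℝ Λ)
    (fun l : Λ => (l : TFPlane d)) b.equivFun.symm.toEquiv
    (coe_equivFun_symm_ofZLatticeBasis Λ b)
  obtain ⟨B', hB'⟩ := exists_tsum_norm_gaussStft_le (symplecticDualBasis (b.ofZLatticeBasis ℝ Λ))
    (fun z : adjointLattice (Λ : Set (TFPlane d)) => (z : TFPlane d)) (adjointLatticeEquiv Λ b)
    (coe_adjointLatticeEquiv Λ b)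
  have : Countable Λ := b.equivFun.injective.countable
  have : Countable (adjointLattice (Λ : Set (TFPlane d))) := countable_adjointLattice Λ
  obtain ⟨hs, ht⟩ := summable_and_tsum_integral_mul (hint hc₁ he₁ hc₂ he₂)
    (fun l : Λ => hmeas l) (fun q => hB q.1.2 q.1.1 q.2.2 q.2.1)
  -- On the adjoint side `g₂` and `f₂` are the signals and `g₁` and `f₁` the windows, hence the
  -- order of the coefficients.
  obtain ⟨hs', ht'⟩ := summable_and_tsum_integral_mul (hint he₂ he₁ hc₂ hc₁)
    (fun z : adjointLattice (Λ : Set (TFPlane d)) => hmeas z)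
    (fun q => hB' q.1.2 q.1.1 q.2.2 q.2.1)
  simp only [stft_mul_conj_stft_eq_integral hc₁ he₁ hc₂ he₂ hf₁ hg₁ hf₂ hg₂,
    stft_mul_conj_stft_eq_integral he₂ he₁ hc₂ hc₁ hg₂ hg₁ hf₂ hf₁]
  refine ⟨hs, hs', ?_⟩
  -- Exchanging the variables of `f₁` and `g₂` gives both integrals the same coefficient; the
  -- integrands then agree pointwise by the Gaussian identity.
  rw [ht, ht', ← measurePreserving_prodExchange.integral_comp', ← integral_const_mul]
  refine integral_congr_ae (.of_forall fun q => ?_)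
  simp only [tsum_gaussStft_mul Λ b, prodExchange, MeasurableEquiv.coe_mk, Equiv.coe_fn_mk, map_mul,
    Complex.conj_conj]
  ring
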